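/- Let $d,n,m,s,t\in\mathbb N$ and put $V=\mathbb R^{d}\oplus\mathbb R^{n+m}$. **Groups.** $\mathrm{TFG}(d,n,m)$ is the set $\mathrm{SO}(d)\times\mathbb R^{d\times n}\times\mathbb R^{d\times m}$ with the law $(R_1,x_1,y_1)(R_2,x_2,y_2)=(R_1R_2,\;x_1+R_1x_2,\;R_2^{-1}y_1+y_2)$. It is identified with the group of matrices $T=\begin{bmatrix}R&r\\0&I\end{bmatrix}$, $r=[x,\,Ry]\in\mathbb R^{d\times(n+m)}$, and carries the corresponding topology. $\mathrm{MFG}(d,n,m,s,t)$ is the type-II semi-direct product extension of $\mathrm{TFG}(d,n,m)$ by the conjugation homomorphism $\phi_T(T')=TT'T^{-1}$. Its elements are $\chi=(T_0;{}^lT_1,\dots,{}^lT_s;{}^rT_1,\dots,{}^rT_t)$ with all components in $\mathrm{TFG}(d,n,m)$. With ${}^lT_0={}^rT_0=T_0$, the product of $\chi$ and $\chi'$ has core component $T_0T_0'$, left components ${}^lT_j\cdot(\phi_{{}^lT_{j-1}}\circ\cdots\circ\phi_{T_0})({}^lT_j')$ and right components $(\phi^{-1}_{{}^rT'_{j-1}}\circ\cdots\circ\phi^{-1}_{T'_0})({}^rT_j)\cdot{}^rT'_j$.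 Its diagonal blocks are $T_0$, ${}^lT_j\cdots{}^lT_1T_0$ ($1\le j\le s$) and $T_0{}^rT_1\cdots{}^rT_j$ ($1\le j\le t$), all $\mathrm{TFG}$-valued. **Observations.** For $\Omega\in\mathrm{SO}(d)$, $\varrho\in\mathbb R^{d\times(n+m)}$, $A\in\mathrm{GL}(n+m,\mathbb R)$ let $S=\begin{bmatrix}\Omega&\varrho\\0&A\end{bmatrix}$; the automorphisms $\psi_S(T)=STS^{-1}$ of $\mathrm{TFG}(d,n,m)$ form the set $\mathcal A_{\mathrm{SIM}}$. Let $\mathcal A$ be $\mathcal A_{\mathrm{SIM}}$; or, if $d$ is odd and $n+m\ge1$, let $\mathcal A$ be either $\mathcal A_{\mathrm{SIM}}$ or the set of all continuous automorphisms (with continuous inverse) of $\mathrm{TFG}(d,n,m)$. A *left-action* (resp. *right-action*) algebraic observation of a diagonal block $\tilde\chi$ of the state $\chi$ is a map $w:\mathrm{MFG}(d,n,m,s,t)\to\mathbb R^d$ for which there are a constant $\psi\in\mathcal A$ and a constant vector $c\in V$ such that, for all $\chi$, $w(\chi)$ is the first row block (first $d$ entries) of $\psi(\tilde\chi)\,c$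 (resp. of $\psi(\tilde\chi^{-1})\,c$). **Notation.** Let $R_0,{}^lR_j,{}^rR_j$ and $r_0,{}^lr_j,{}^rr_j$ be the rotation and translation parts of the components of $\chi$, with ${}^{l}R_0={}^rR_0=R_0$ and ${}^lr_0={}^rr_0=r_0$. For $(\cdot)\in\{l,r\}$ let ${}^{(\cdot)}\bar R_{i,j}={}^{(\cdot)}R_i\,{}^{(\cdot)}R_{i\pm1}\cdots{}^{(\cdot)}R_j$ be the successive product with indices running monotonically from $i$ to $j$, and let $\mathcal C_\Omega R=\Omega R\Omega^{-1}$. Put $${}^l\bar r_j={}^lr_j+\sum_{k=0}^{j-1}{}^l\bar R_{j,k+1}{}^lr_k,\qquad {}^r\bar r_j=r_0+\sum_{k=1}^{j}{}^r\bar R_{0,k-1}{}^rr_k,$$ $${}^l\underline r_j=\sum_{k=0}^{j}{}^l\bar R_{k,0}^{-1}{}^lr_k,\qquad {}^r\underline r_j=\sum_{k=0}^{j}{}^r\bar R_{k,j}^{-1}{}^rr_k .$$ **Theorem.** A map $w:\mathrm{MFG}(d,n,m,s,t)\to\mathbb R^d$ is a left-action algebraic observation of the block $T_0$, respectively ${}^lT_j\cdots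 T_0$ ($1\le j\le s$), respectively $T_0\cdots{}^rT_j$ ($1\le j\le t$), if and only if there are constants $\Omega\in\mathrm{SO}(d)$, $\varrho\in\mathbb R^{d\times(n+m)}$, $d^{(1)}\in\mathbb R^d$, $d^{(2)}\in\mathbb R^{n+m}$ such that, for all $\chi$, respectively, $$w=(\mathcal C_{\Omega}R_0)d^{(1)}+(\Omega r_0+\varrho)d^{(2)},$$ $$w=(\mathcal C_{\Omega}{}^l\bar R_{j,0})d^{(1)}+(\varrho+\Omega\,{}^l\bar r_j)d^{(2)},$$ $$w=(\mathcal C_{\Omega}{}^r\bar R_{0,j})d^{(1)}+(\varrho+\Omega\,{}^r\bar r_j)d^{(2)} .$$ It is a right-action algebraic observation of the block $T_0$, respectively ${}^lT_j\cdots T_0$ ($1\le j\le s$), respectively $T_0\cdots{}^rT_j$ ($1\le j\le t$), if and only if there are such constants with, for all $\chi$, respectively, $$w=(\mathcal C_{\Omega}R_0^{-1})d^{(1)}+(\varrho-\Omega R_0^{-1}r_0)d^{(2)},$$ $$w=(\mathcal C_{\Omega}{}^l\bar R_{j,0}^{-1})d^{(1)}+(\varrho-\Omega\,{}^l\underline r_j)d^{(2)},$$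 $$w=(\mathcal C_{\Omega}{}^r\bar R_{0,j}^{-1})d^{(1)}+(\varrho-\Omega\,{}^r\underline r_j)d^{(2)} .$$ -/

import Mathlib

open scoped Matrix

noncomputable section

/-- The rotation group `SO(d)`. -/
abbrev SO (d : ℕ) : Type := Matrix.specialOrthogonalGroup (Fin d) ℝ

/-! ### Successive products -/

/-- The successive product `R_i R_{i+1} ⋯ R_j` if `i ≤ j` and `R_i R_{i-1} ⋯ R_j` if `i > j`
(a single factor if `i = j`). -/
def succMul {G : Type*} [Monoid G] (R : ℕ → G) (i j : ℕ) : G :=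
  if i ≤ j then ((List.range (j + 1 - i)).map fun k => R (i + k)).prod
  else ((List.range (i + 1 - j)).map fun k => R (i - k)).prod

theorem succMul_self {G : Type*} [Monoid G] (R : ℕ → G) (i : ℕ) : succMul R i i = R i := by
  simp [succMul]

theorem succMul_zero_succ {G : Type*} [Monoid G] (R : ℕ → G) (j : ℕ) :
    succMul R 0 (j + 1) = succMul R 0 j * R (j + 1) := by
  simp [succMul, List.range_succ, mul_assoc]

theorem succMul_succ_zero {G : Type*} [Monoid G] (R : ℕ → G) (j : ℕ) :
    succMul R (j + 1) 0 = R (j + 1) * succMul R j 0 := by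
  rcases j with _ | j
  · simp [succMul, List.range_succ]
  · simp only [succMul]
    rw [if_neg (by omega), if_neg (by omega)]
    rw [show j + 1 + 1 + 1 - 0 = (j + 1 + 1 - 0) + 1 by omega, List.range_succ_eq_map]
    simp only [List.map_cons, List.prod_cons, List.map_map, Nat.sub_zero]
    congr 2
    refine List.map_congr_left fun k _ => ?_
    simp only [Function.comp_apply]
    congr 1
    omega

/-! ### The two-frame group -/

/-- The two-frame group `TFG(d,n,m)`: the set `SO(d) × (ℝ^d)^n × (ℝ^d)^m`, whose element is a
rotation `R`, a matrix `x` of `n` columns (world-frame vectors) and a matrix `y` of `m` columns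
(body-frame vectors). -/
@[ext]
structure TFG (d n m : ℕ) where
  R : SO d
  x : Matrix (Fin d) (Fin n) ℝ
  y : Matrix (Fin d) (Fin m) ℝ

namespace TFG

variable {d n m : ℕ}

/-- The group law: `(R₁, x₁, y₁)(R₂, x₂, y₂) = (R₁R₂, x₁ + R₁x₂, R₂⁻¹y₁ + y₂)`. -/
instance : Mul (TFG d n m) :=
  ⟨fun a b => ⟨a.R * b.R, a.x + (a.R : Matrix (Fin d) (Fin d) ℝ) * b.x,
    ((b.R⁻¹ : SO d) : Matrix (Fin d) (Fin d) ℝ) * a.y + b.y⟩⟩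

instance : One (TFG d n m) := ⟨⟨1, 0, 0⟩⟩

instance : Inv (TFG d n m) :=
  ⟨fun a => ⟨a.R⁻¹, -(((a.R⁻¹ : SO d) : Matrix (Fin d) (Fin d) ℝ) * a.x),
    -((a.R : Matrix (Fin d) (Fin d) ℝ) * a.y)⟩⟩

@[simp] theorem mul_R (a b : TFG d n m) : (a * b).R = a.R * b.R := rfl
@[simp] theorem mul_x (a b : TFG d n m) :
    (a * b).x = a.x + (a.R : Matrix (Fin d) (Fin d) ℝ) * b.x := rfl
@[simp] theorem mul_y (a b : TFG d n m) :
    (a * b).y = ((b.R⁻¹ : SO d) : Matrix (Fin d) (Fin d) ℝ) * a.y + b.y := rfl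
@[simp] theorem one_R : (1 : TFG d n m).R = 1 := rfl
@[simp] theorem one_x : (1 : TFG d n m).x = 0 := rfl
@[simp] theorem one_y : (1 : TFG d n m).y = 0 := rfl
@[simp] theorem inv_R (a : TFG d n m) : (a⁻¹).R = a.R⁻¹ := rfl
@[simp] theorem inv_x (a : TFG d n m) :
    (a⁻¹).x = -(((a.R⁻¹ : SO d) : Matrix (Fin d) (Fin d) ℝ) * a.x) := rfl
@[simp] theorem inv_y (a : TFG d n m) :
    (a⁻¹).y = -((a.R : Matrix (Fin d) (Fin d) ℝ) * a.y) := rfl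

theorem coe_mul_coe_inv (R : SO d) :
    (R : Matrix (Fin d) (Fin d) ℝ) * ((R⁻¹ : SO d) : Matrix (Fin d) (Fin d) ℝ) = 1 := by
  rw [← Submonoid.coe_mul, mul_inv_cancel, Submonoid.coe_one]

theorem coe_inv_mul_coe (R : SO d) :
    ((R⁻¹ : SO d) : Matrix (Fin d) (Fin d) ℝ) * (R : Matrix (Fin d) (Fin d) ℝ) = 1 := by
  rw [← Submonoid.coe_mul, inv_mul_cancel, Submonoid.coe_one]

instance : Group (TFG d n m) :=
  Group.ofLeftAxioms
    (fun a b c => by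
      ext1
      · simp [mul_assoc]
      · simp only [mul_x, mul_R, Submonoid.coe_mul, Matrix.mul_add, Matrix.mul_assoc, add_assoc]
      · simp only [mul_y, mul_R, mul_inv_rev, Submonoid.coe_mul, Matrix.mul_add,
          Matrix.mul_assoc, add_assoc])
    (fun a => by ext1 <;> simp)
    (fun a => by
      ext1
      · simp
      · simp
      · simp [← Matrix.mul_assoc, coe_inv_mul_coe])

/-- The translation part `r = [x, Ry] ∈ ℝ^{d×(n+m)}`. -/
def r (T : TFG d n m) : Matrix (Fin d) (Fin n ⊕ Fin m) ℝ :=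
  Matrix.fromCols T.x ((T.R : Matrix (Fin d) (Fin d) ℝ) * T.y)

/-- The matrix embedding `T ↦ [R r; 0 I]`. -/
def toMatrix (T : TFG d n m) :
    Matrix (Fin d ⊕ (Fin n ⊕ Fin m)) (Fin d ⊕ (Fin n ⊕ Fin m)) ℝ :=
  Matrix.fromBlocks (T.R : Matrix (Fin d) (Fin d) ℝ) T.r 0 1

@[simp] theorem mul_r (a b : TFG d n m) :
    (a * b).r = (a.R : Matrix (Fin d) (Fin d) ℝ) * b.r + a.r := by
  ext i j
  rcases j with j | j
  · simp [r, Matrix.mul_fromCols, add_comm]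
  · simp only [r, mul_R, mul_y, Submonoid.coe_mul, Matrix.mul_fromCols, Matrix.fromCols_apply_inr,
      Matrix.add_apply, Matrix.mul_add]
    rw [Matrix.mul_assoc, ← Matrix.mul_assoc _ _ a.y, coe_mul_coe_inv, Matrix.one_mul, add_comm,
      Matrix.mul_assoc]

theorem toMatrix_mul (a b : TFG d n m) : (a * b).toMatrix = a.toMatrix * b.toMatrix := by
  simp [toMatrix, Matrix.fromBlocks_multiply]

/-- The topology of `TFG(d,n,m)` as a matrix group. -/
instance : TopologicalSpace (TFG d n m) := TopologicalSpace.induced toMatrix inferInstance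

end TFG

/-! ### The multi-frame group -/

/-- The underlying set `G × G^s × G^t` of the type-II semi-direct product extended group of `G`.
In the numbering `j = 1, …, s` (resp. `j = 1, …, t`), the `j`-th left (resp. right) component is
`left ⟨j - 1, _⟩` (resp. `right ⟨j - 1, _⟩`). -/
@[ext]
structure TypeIIExt (G : Type*) (s t : ℕ) where
  core : G
  left : Fin s → G
  right : Fin t → G

namespace TypeIIExt

variable {G : Type*} [Group G] {s t : ℕ}

/-- The sequence `T₀, ˡT₁, …, ˡT_s` (continued by the identity, which is never used). -/
def lT (a : TypeIIExt G s t) : ℕ → G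
  | 0 => a.core
  | k + 1 => if h : k < s then a.left ⟨k, h⟩ else 1

/-- The sequence `T₀, ʳT₁, …, ʳT_t` (continued by the identity, which is never used). -/
def rT (a : TypeIIExt G s t) : ℕ → G
  | 0 => a.core
  | k + 1 => if h : k < t then a.right ⟨k, h⟩ else 1

/-- The type-II group law for the homomorphism `φ = MulAut.conj : G → Aut(G)`: the left components
of the product are `g_j · (φ_{g_{j-1}} ∘ ⋯ ∘ φ_{g_0})(g'_j)`, the right components are
`(φ⁻¹_{g'_{j-1}} ∘ ⋯ ∘ φ⁻¹_{g'_0})(g_j) · g'_j`. -/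
instance : Mul (TypeIIExt G s t) :=
  ⟨fun a b =>
    { core := a.core * b.core
      left := fun j =>
        a.left j * (succMul (fun k => MulAut.conj (a.lT k)) j 0) (b.left j)
      right := fun j =>
        (succMul (fun k => (MulAut.conj (b.rT k))⁻¹) j 0) (a.right j) * b.right j }⟩

instance : One (TypeIIExt G s t) := ⟨⟨1, fun _ => 1, fun _ => 1⟩⟩

/-- The diagonal block `ˡT_j ⋯ ˡT_1 T_0` (which is `T_0` for `j = 0`). -/
def lBlock (a : TypeIIExt G s t) (j : ℕ) : G := succMul a.lT j 0

/-- The diagonal block `T_0 ʳT_1 ⋯ ʳT_j` (which is `T_0` for `j = 0`). -/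
def rBlock (a : TypeIIExt G s t) (j : ℕ) : G := succMul a.rT 0 j

instance : Inv (TypeIIExt G s t) :=
  ⟨fun a =>
    { core := a.core⁻¹
      left := fun j => (a.lBlock (j + 1))⁻¹ * a.lBlock j
      right := fun j => a.rBlock j * (a.rBlock (j + 1))⁻¹ }⟩

theorem lBlock_zero (a : TypeIIExt G s t) : a.lBlock 0 = a.core := by
  simp [lBlock, succMul_self, lT]

theorem rBlock_zero (a : TypeIIExt G s t) : a.rBlock 0 = a.core := by
  simp [rBlock, succMul_self, rT]

theorem lBlock_succ (a : TypeIIExt G s t) (j : Fin s) :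
    a.lBlock (j + 1) = a.left j * a.lBlock j := by
  simp [lBlock, succMul_succ_zero, lT]

theorem rBlock_succ (a : TypeIIExt G s t) (j : Fin t) :
    a.rBlock (j + 1) = a.rBlock j * a.right j := by
  simp [rBlock, succMul_zero_succ, rT]

theorem succMul_conj (R : ℕ → G) (j : ℕ) :
    succMul (fun k => MulAut.conj (R k)) j 0 = MulAut.conj (succMul R j 0) := by
  induction j with
  | zero => simp [succMul_self]
  | succ j ih => rw [succMul_succ_zero, succMul_succ_zero, ih, map_mul]

theorem succMul_conj_inv (R : ℕ → G) (j : ℕ) :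
    succMul (fun k => (MulAut.conj (R k))⁻¹) j 0 = (MulAut.conj (succMul R 0 j))⁻¹ := by
  induction j with
  | zero => simp [succMul_self]
  | succ j ih => rw [succMul_succ_zero, succMul_zero_succ, ih, map_mul, mul_inv_rev]

theorem mul_left_apply (a b : TypeIIExt G s t) (j : Fin s) :
    (a * b).left j = a.left j * (a.lBlock j * b.left j * (a.lBlock j)⁻¹) := by
  change a.left j * (succMul (fun k => MulAut.conj (a.lT k)) j 0) (b.left j) = _
  rw [succMul_conj]
  rfl

theorem mul_right_apply (a b : TypeIIExt G s t) (j : Fin t) :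
    (a * b).right j = ((b.rBlock j)⁻¹ * a.right j * b.rBlock j) * b.right j := by
  change (succMul (fun k => (MulAut.conj (b.rT k))⁻¹) j 0) (a.right j) * b.right j = _
  rw [succMul_conj_inv]
  simp [rBlock]

/-- The diagonal blocks are multiplicative: this is the block-diagonal embedding. -/
theorem lBlock_mul (a b : TypeIIExt G s t) (j : ℕ) (hj : j ≤ s) :
    (a * b).lBlock j = a.lBlock j * b.lBlock j := by
  induction j with
  | zero => simp only [lBlock_zero]; rfl
  | succ j ih =>
    have e (c : TypeIIExt G s t) := c.lBlock_succ ⟨j, hj⟩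
    simp only at e
    rw [e, e, e, ih (by omega), mul_left_apply]
    group

theorem rBlock_mul (a b : TypeIIExt G s t) (j : ℕ) (hj : j ≤ t) :
    (a * b).rBlock j = a.rBlock j * b.rBlock j := by
  induction j with
  | zero => simp only [rBlock_zero]; rfl
  | succ j ih =>
    have e (c : TypeIIExt G s t) := c.rBlock_succ ⟨j, hj⟩
    simp only at e
    rw [e, e, e, ih (by omega), mul_right_apply]
    group

theorem ext_blocks {a b : TypeIIExt G s t} (hl : ∀ j ≤ s, a.lBlock j = b.lBlock j)
    (hr : ∀ j ≤ t, a.rBlock j = b.rBlock j) : a = b := by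
  ext1
  · simpa [lBlock_zero] using hl 0 (Nat.zero_le _)
  · funext j
    have h := hl (j + 1) j.2
    rw [lBlock_succ, lBlock_succ, hl j j.2.le] at h
    exact mul_right_cancel h
  · funext j
    have h := hr (j + 1) j.2
    rw [rBlock_succ, rBlock_succ, hr j j.2.le] at h
    exact mul_left_cancel h

theorem lBlock_one (j : ℕ) (hj : j ≤ s) : (1 : TypeIIExt G s t).lBlock j = 1 := by
  induction j with
  | zero => rw [lBlock_zero]; rfl
  | succ j ih =>
    have e := (1 : TypeIIExt G s t).lBlock_succ ⟨j, hj⟩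
    simp only at e
    rw [e, ih (by omega), mul_one]
    rfl

theorem rBlock_one (j : ℕ) (hj : j ≤ t) : (1 : TypeIIExt G s t).rBlock j = 1 := by
  induction j with
  | zero => rw [rBlock_zero]; rfl
  | succ j ih =>
    have e := (1 : TypeIIExt G s t).rBlock_succ ⟨j, hj⟩
    simp only at e
    rw [e, ih (by omega), one_mul]
    rfl

theorem lBlock_inv (a : TypeIIExt G s t) (j : ℕ) (hj : j ≤ s) :
    (a⁻¹).lBlock j = (a.lBlock j)⁻¹ := by
  induction j with
  | zero => rw [lBlock_zero, lBlock_zero]; rfl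
  | succ j ih =>
    have e := (a⁻¹).lBlock_succ ⟨j, hj⟩
    simp only at e
    rw [e, ih (by omega)]
    exact mul_inv_cancel_right _ _

theorem rBlock_inv (a : TypeIIExt G s t) (j : ℕ) (hj : j ≤ t) :
    (a⁻¹).rBlock j = (a.rBlock j)⁻¹ := by
  induction j with
  | zero => rw [rBlock_zero, rBlock_zero]; rfl
  | succ j ih =>
    have e := (a⁻¹).rBlock_succ ⟨j, hj⟩
    simp only at e
    rw [e, ih (by omega)]
    exact inv_mul_cancel_left _ _

instance : Group (TypeIIExt G s t) :=
  Group.ofLeftAxioms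
    (fun a b c => ext_blocks
      (fun j hj => by simp only [lBlock_mul _ _ j hj, mul_assoc])
      (fun j hj => by simp only [rBlock_mul _ _ j hj, mul_assoc]))
    (fun a => ext_blocks
      (fun j hj => by simp only [lBlock_mul _ _ j hj, lBlock_one j hj, one_mul])
      (fun j hj => by simp only [rBlock_mul _ _ j hj, rBlock_one j hj, one_mul]))
    (fun a => ext_blocks
      (fun j hj => by
        simp only [lBlock_mul _ _ j hj, lBlock_inv _ j hj, lBlock_one j hj, inv_mul_cancel])
      (fun j hj => by
        simp only [rBlock_mul _ _ j hj, rBlock_inv _ j hj, rBlock_one j hj, inv_mul_cancel]))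

end TypeIIExt

/-- The multi-frame group `MFG(d,n,m,s,t)`. -/
abbrev MFG (d n m s t : ℕ) : Type := TypeIIExt (TFG d n m) s t

namespace MFG

variable {d n m s t : ℕ}

/-- The rotations `R₀, ˡR₁, …, ˡR_s`. -/
def lR (χ : MFG d n m s t) (k : ℕ) : SO d := (χ.lT k).R

/-- The rotations `R₀, ʳR₁, …, ʳR_t`. -/
def rR (χ : MFG d n m s t) (k : ℕ) : SO d := (χ.rT k).R

/-- The translations `r₀, ˡr₁, …, ˡr_s`. -/
def lr (χ : MFG d n m s t) (k : ℕ) : Matrix (Fin d) (Fin n ⊕ Fin m) ℝ := (χ.lT k).r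

/-- The translations `r₀, ʳr₁, …, ʳr_t`. -/
def rr (χ : MFG d n m s t) (k : ℕ) : Matrix (Fin d) (Fin n ⊕ Fin m) ℝ := (χ.rT k).r

/-- The chained rotations `ˡR̄_{i,j}`. -/
def lRbar (χ : MFG d n m s t) (i j : ℕ) : SO d := succMul χ.lR i j

/-- The chained rotations `ʳR̄_{i,j}`. -/
def rRbar (χ : MFG d n m s t) (i j : ℕ) : SO d := succMul χ.rR i j

/-- `ˡr̄_j = ˡr_j + ∑_{k=0}^{j-1} ˡR̄_{j,k+1} ˡr_k`. -/
def lrBar (χ : MFG d n m s t) (j : ℕ) : Matrix (Fin d) (Fin n ⊕ Fin m) ℝ :=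
  χ.lr j + ∑ k ∈ Finset.range j, (χ.lRbar j (k + 1) : Matrix (Fin d) (Fin d) ℝ) * χ.lr k

/-- `ʳr̄_j = r_0 + ∑_{k=1}^{j} ʳR̄_{0,k-1} ʳr_k`. -/
def rrBar (χ : MFG d n m s t) (j : ℕ) : Matrix (Fin d) (Fin n ⊕ Fin m) ℝ :=
  χ.rr 0 + ∑ k ∈ Finset.Icc 1 j, (χ.rRbar 0 (k - 1) : Matrix (Fin d) (Fin d) ℝ) * χ.rr k

/-- `ˡr̲_j = ∑_{k=0}^{j} ˡR̄_{k,0}⁻¹ ˡr_k`. -/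
def lrUnder (χ : MFG d n m s t) (j : ℕ) : Matrix (Fin d) (Fin n ⊕ Fin m) ℝ :=
  ∑ k ∈ Finset.range (j + 1),
    (((χ.lRbar k 0)⁻¹ : SO d) : Matrix (Fin d) (Fin d) ℝ) * χ.lr k

/-- `ʳr̲_j = ∑_{k=0}^{j} ʳR̄_{k,j}⁻¹ ʳr_k`. -/
def rrUnder (χ : MFG d n m s t) (j : ℕ) : Matrix (Fin d) (Fin n ⊕ Fin m) ℝ :=
  ∑ k ∈ Finset.range (j + 1),
    (((χ.rRbar k j)⁻¹ : SO d) : Matrix (Fin d) (Fin d) ℝ) * χ.rr k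

end MFG

/-! ### Automorphisms and algebraic observations -/

/-- The matrix `[Ω ϱ; 0 A]`, a general element of `SIM_{n+m}(d)`. -/
def simMatrix {d n m : ℕ} (Ω : SO d) (ϱ : Matrix (Fin d) (Fin n ⊕ Fin m) ℝ)
    (A : GL (Fin n ⊕ Fin m) ℝ) :
    Matrix (Fin d ⊕ (Fin n ⊕ Fin m)) (Fin d ⊕ (Fin n ⊕ Fin m)) ℝ :=
  Matrix.fromBlocks (Ω : Matrix (Fin d) (Fin d) ℝ) ϱ 0 (A : Matrix (Fin n ⊕ Fin m) (Fin n ⊕ Fin m) ℝ)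

/-- The automorphisms `T ↦ S T S⁻¹` of the Lie group `TFG(d,n,m)`, with `S ∈ SIM_{n+m}(d)`. -/
def simAut (d n m : ℕ) : Set (TFG d n m ≃ₜ* TFG d n m) :=
  {ψ | ∃ (Ω : SO d) (ϱ : Matrix (Fin d) (Fin n ⊕ Fin m) ℝ) (A : GL (Fin n ⊕ Fin m) ℝ),
    ∀ T, (ψ T).toMatrix = simMatrix Ω ϱ A * T.toMatrix * (simMatrix Ω ϱ A)⁻¹}

/-- `w` is a left-action algebraic observation of the `TFG`-valued block `B` of the state: the
first row block (the first `d` entries) of `ψ(B χ) · c`, where `ψ` is a fixed automorphism in `𝒜`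
and `c ∈ ℝ^{d+n+m}` is a fixed vector. -/
def IsLeftObservation {X : Type*} {d n m : ℕ} (𝒜 : Set (TFG d n m ≃ₜ* TFG d n m))
    (B : X → TFG d n m) (w : X → Fin d → ℝ) : Prop :=
  ∃ ψ ∈ 𝒜, ∃ c : Fin d ⊕ (Fin n ⊕ Fin m) → ℝ,
    ∀ χ, w χ = fun i => ((ψ (B χ)).toMatrix *ᵥ c) (Sum.inl i)

/-- `w` is a right-action algebraic observation of the block `B`: the first row block of
`ψ((B χ)⁻¹) · c`, where `ψ ∈ 𝒜` and `c` are fixed. -/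
def IsRightObservation {X : Type*} {d n m : ℕ} (𝒜 : Set (TFG d n m ≃ₜ* TFG d n m))
    (B : X → TFG d n m) (w : X → Fin d → ℝ) : Prop :=
  ∃ ψ ∈ 𝒜, ∃ c : Fin d ⊕ (Fin n ⊕ Fin m) → ℝ,
    ∀ χ, w χ = fun i => ((ψ (B χ)⁻¹).toMatrix *ᵥ c) (Sum.inl i)

/-- The matrix `𝒞_Ω R = Ω R Ω⁻¹`. -/
def conjRot {d : ℕ} (Ω R : SO d) : Matrix (Fin d) (Fin d) ℝ :=
  ((MulAut.conj Ω R : SO d) : Matrix (Fin d) (Fin d) ℝ)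

end

/-! For ψ = conjugation by S = [Ω ϱ; 0 A], the rotation part of ψ(T) is ΩRΩ⁻¹ and its translation
part r' satisfies r'A = Ωr + ϱ − (ΩRΩ⁻¹)ϱ. Applied to c = (c₁, A d₂), the first row block is
(ΩRΩ⁻¹)(c₁ − ϱd₂) + (ϱ + Ωr)d₂, so A is absorbed in c and d₁ = c₁ − ϱd₂ is arbitrary
(`isLeftObservation_simAut_iff`). Right actions are left actions of the inverse block, and the
stated formulas come from the rotation and translation parts of the blocks, by induction on j.

For odd d and n+m ≥ 1, every bicontinuous automorphism ψ is such a conjugation (`simAut_eq_univ`).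
It preserves the abelian normal subgroup of translations and acts there by a real-linear L with
L(Rv) = α(R)L(v), where α(R) is the rotation part of ψ(R, 0). A Schur argument in odd dimension
gives L(v) = ΩvB and α = conjugation by Ω. The translation part of ψ(R, 0) is a continuous cocycle
on a compact group, hence a coboundary by Haar averaging; it supplies ϱ. -/

noncomputable section

/-! ### Recursions for successive products -/

section SuccessiveProducts

/-- The lower index is arbitrary because the partial products in ʳr̲ need not start at 0. -/
theorem succMul_succ_right {G : Type*} [Monoid G] (R : ℕ → G) {i j : ℕ} (h : i ≤ j) :
    succMul R i (j + 1) = succMul R i j * R (j + 1) := by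
  simp only [succMul]
  rw [if_pos (by omega), if_pos h, show j + 1 + 1 - i = (j + 1 - i) + 1 by omega,
    List.range_succ, List.map_append, List.prod_append]
  simp only [List.map_cons, List.map_nil, List.prod_singleton]
  congr 2
  omega

theorem succMul_succ_left {G : Type*} [Monoid G] (R : ℕ → G) {i j : ℕ} (h : i ≤ j) :
    succMul R (j + 1) i = R (j + 1) * succMul R j i := by
  rcases h.eq_or_lt with rfl | h
  · rw [succMul_self]
    simp only [succMul]
    rw [if_neg (by omega), show i + 1 + 1 - i = 2 by omega]
    simp [List.range_succ]
  · simp only [succMul]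
    rw [if_neg (by omega), if_neg (by omega), show j + 1 + 1 - i = (j + 1 - i) + 1 by omega,
      List.range_succ_eq_map]
    simp only [List.map_cons, List.prod_cons, List.map_map, Nat.sub_zero]
    congr 2
    refine List.map_congr_left fun k _ => ?_
    simp only [Function.comp_apply]
    congr 1
    omega

theorem map_succMul {G H : Type*} [Monoid G] [Monoid H] (f : G →* H) (R : ℕ → G) (i j : ℕ) :
    f (succMul R i j) = succMul (fun k => f (R k)) i j := by
  unfold succMul
  split_ifs <;> simp [map_list_prod, Function.comp_def]

end SuccessiveProducts

/-! ### Rotation and translation coordinates on the two-frame group -/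

namespace TFG

variable {d n m : ℕ}

/-- The rotation part as a homomorphism. -/
def rotHom : TFG d n m →* SO d where
  toFun := TFG.R
  map_one' := rfl
  map_mul' _ _ := rfl

theorem inv_r (T : TFG d n m) :
    (T⁻¹).r = -(((T.R⁻¹ : SO d) : Matrix (Fin d) (Fin d) ℝ) * T.r) := by
  have h : (T⁻¹ * T).r = 0 := by
    rw [inv_mul_cancel]
    ext i (j | j) <;> simp [r]
  rw [mul_r, inv_R] at h
  exact eq_neg_of_add_eq_zero_right h

/-- The element of `TFG(d,n,m)` with rotation part `R` and translation part `r`. -/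
def ofRot (R : SO d) (r : Matrix (Fin d) (Fin n ⊕ Fin m) ℝ) : TFG d n m :=
  ⟨R, r.toCols₁, ((R⁻¹ : SO d) : Matrix (Fin d) (Fin d) ℝ) * r.toCols₂⟩

@[simp] theorem ofRot_R (R : SO d) (r : Matrix (Fin d) (Fin n ⊕ Fin m) ℝ) :
    (ofRot R r).R = R := rfl

@[simp] theorem ofRot_r (R : SO d) (r : Matrix (Fin d) (Fin n ⊕ Fin m) ℝ) :
    (ofRot R r).r = r := by
  simp [ofRot, TFG.r, ← Matrix.mul_assoc, coe_mul_coe_inv]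

/-- Since r = [x, Ry] and R is invertible, y is recovered from R and r. -/
theorem ext_r {a b : TFG d n m} (hR : a.R = b.R) (hr : a.r = b.r) : a = b := by
  obtain ⟨R, x, y⟩ := a
  obtain ⟨R', x', y'⟩ := b
  obtain rfl : R = R' := hR
  obtain ⟨rfl, hy⟩ := Matrix.fromCols_inj hr
  have := congrArg (fun z => ((R⁻¹ : SO d) : Matrix (Fin d) (Fin d) ℝ) * z) hy
  simp only [← Matrix.mul_assoc, coe_inv_mul_coe, Matrix.one_mul] at this
  rw [this]

theorem ofRot_eta (T : TFG d n m) : ofRot T.R T.r = T := ext_r (by simp) (by simp)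

theorem ofRot_mul (R R' : SO d) (r r' : Matrix (Fin d) (Fin n ⊕ Fin m) ℝ) :
    ofRot R r * ofRot R' r' =
      ofRot (R * R') ((R : Matrix (Fin d) (Fin d) ℝ) * r' + r) :=
  ext_r (by simp) (by simp)

theorem continuous_toMatrix : Continuous (toMatrix : TFG d n m → _) := continuous_induced_dom

theorem continuous_r : Continuous (r : TFG d n m → _) :=
  continuous_matrix fun i j =>
    (continuous_toMatrix (d := d) (n := n) (m := m)).matrix_elem (.inl i) (.inr j)

theorem continuous_of_coe {X : Type*} [TopologicalSpace X] {f : X → TFG d n m}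
    (hR : Continuous fun x => ((f x).R : Matrix (Fin d) (Fin d) ℝ))
    (hr : Continuous fun x => (f x).r) : Continuous f :=
  continuous_induced_rng.2 (hR.matrix_fromBlocks hr continuous_const continuous_const)

theorem continuous_conj (g : TFG d n m) : Continuous fun T : TFG d n m => g * T * g⁻¹ := by
  refine continuous_induced_rng.2 ?_
  simp only [Function.comp_def, toMatrix_mul]
  exact (continuous_const.mul continuous_toMatrix).mul continuous_const

/-- Conjugation by an element of `TFG(d,n,m)`, as a bicontinuous automorphism. -/
def conjAut (g : TFG d n m) : TFG d n m ≃ₜ* TFG d n m where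
  toMulEquiv := MulAut.conj g
  continuous_toFun := continuous_conj g
  continuous_invFun := by
    refine (continuous_conj g⁻¹).congr fun T => ?_
    rw [inv_inv]
    rfl

theorem toMatrix_mulVec_inl (T : TFG d n m) (c : Fin d ⊕ (Fin n ⊕ Fin m) → ℝ) :
    (fun i => (T.toMatrix *ᵥ c) (Sum.inl i)) =
      (T.R : Matrix (Fin d) (Fin d) ℝ) *ᵥ (c ∘ Sum.inl) + T.r *ᵥ (c ∘ Sum.inr) := by
  rw [toMatrix, Matrix.fromBlocks_mulVec]
  rfl

end TFG

/-! ### Conjugations by similarity matrices and their observations -/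

section SimAut

variable {d n m : ℕ}

theorem isUnit_det_simMatrix (Ω : SO d) (ϱ : Matrix (Fin d) (Fin n ⊕ Fin m) ℝ)
    (A : GL (Fin n ⊕ Fin m) ℝ) : IsUnit (simMatrix Ω ϱ A).det := by
  rw [simMatrix, Matrix.det_fromBlocks_zero₂₁]
  refine IsUnit.mul ?_ ((Matrix.isUnit_iff_isUnit_det _).1 A.isUnit)
  exact (Matrix.isUnit_iff_isUnit_det _).1 (IsUnit.of_mul_eq_one _ (TFG.coe_mul_coe_inv Ω))

/-- Compare the blocks of ψ(T)S = ST, which involves no inverse; the lower blocks agree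
automatically. -/
theorem mem_simAut_iff (ψ : TFG d n m ≃ₜ* TFG d n m) :
    ψ ∈ simAut d n m ↔ ∃ (Ω : SO d) (ϱ : Matrix (Fin d) (Fin n ⊕ Fin m) ℝ)
      (A : GL (Fin n ⊕ Fin m) ℝ), ∀ T : TFG d n m, (ψ T).R = MulAut.conj Ω T.R ∧
        (ψ T).r * (A : Matrix (Fin n ⊕ Fin m) (Fin n ⊕ Fin m) ℝ) =
          (Ω : Matrix (Fin d) (Fin d) ℝ) * T.r + ϱ - conjRot Ω T.R * ϱ := by
  refine exists_congr fun Ω => exists_congr fun ϱ => exists_congr fun A =>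
    forall_congr' fun T => ?_
  have hS := isUnit_det_simMatrix Ω ϱ A
  have : (ψ T).toMatrix = simMatrix Ω ϱ A * T.toMatrix * (simMatrix Ω ϱ A)⁻¹ ↔
      (ψ T).toMatrix * simMatrix Ω ϱ A = simMatrix Ω ϱ A * T.toMatrix := by
    constructor
    · intro h
      rw [h, Matrix.mul_assoc, Matrix.nonsing_inv_mul _ hS, Matrix.mul_one]
    · intro h
      rw [← h, Matrix.mul_assoc, Matrix.mul_nonsing_inv _ hS, Matrix.mul_one]
  rw [this, simMatrix, TFG.toMatrix, TFG.toMatrix, Matrix.fromBlocks_multiply,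
    Matrix.fromBlocks_multiply, Matrix.fromBlocks_inj]
  simp only [Matrix.mul_zero, Matrix.zero_mul, add_zero, zero_add, Matrix.one_mul, Matrix.mul_one,
    and_true]
  rw [← Submonoid.coe_mul, ← Submonoid.coe_mul, Subtype.coe_inj, MulAut.conj_apply,
    eq_mul_inv_iff_mul_eq]
  refine and_congr_right fun h => ?_
  rw [eq_sub_iff_add_eq, conjRot, MulAut.conj_apply, eq_mul_inv_iff_mul_eq.2 h, add_comm]

theorem conjAut_r (g T : TFG d n m) :
    (TFG.conjAut g T).r =
      (g.R : Matrix (Fin d) (Fin d) ℝ) * T.r + g.r - conjRot g.R T.R * g.r := by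
  change (g * T * g⁻¹).r = _
  rw [TFG.mul_r, TFG.mul_r, TFG.inv_r, conjRot, MulAut.conj_apply, TFG.mul_R,
    Submonoid.coe_mul _ (g.R * T.R), Matrix.mul_neg, ← Matrix.mul_assoc]
  abel

theorem conjAut_mem_simAut (g : TFG d n m) : TFG.conjAut g ∈ simAut d n m :=
  (mem_simAut_iff _).2 ⟨g.R, g.r, 1, fun T => ⟨rfl, by
    rw [Units.val_one, Matrix.mul_one, conjAut_r]⟩⟩

/-- The first row block of `ψ(T) c`, for `ψ` a conjugation by a similarity matrix. -/
theorem isLeftObservation_simAut_iff {X : Type*} (B : X → TFG d n m) (w : X → Fin d → ℝ) :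
    IsLeftObservation (simAut d n m) B w ↔
      ∃ (Ω : SO d) (ϱ : Matrix (Fin d) (Fin n ⊕ Fin m) ℝ)
        (d₁ : Fin d → ℝ) (d₂ : Fin n ⊕ Fin m → ℝ),
        ∀ χ, w χ = conjRot Ω (B χ).R *ᵥ d₁ +
          (ϱ + (Ω : Matrix (Fin d) (Fin d) ℝ) * (B χ).r) *ᵥ d₂ := by
  have key (Ω : SO d) (ϱ : Matrix (Fin d) (Fin n ⊕ Fin m) ℝ) (A : GL (Fin n ⊕ Fin m) ℝ)
      (U T : TFG d n m) (hR : U.R = MulAut.conj Ω T.R)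
      (hr : U.r * (A : Matrix (Fin n ⊕ Fin m) (Fin n ⊕ Fin m) ℝ) =
          (Ω : Matrix (Fin d) (Fin d) ℝ) * T.r + ϱ - conjRot Ω T.R * ϱ)
      (c₁ : Fin d → ℝ) (c₂ : Fin n ⊕ Fin m → ℝ) :
      (U.R : Matrix (Fin d) (Fin d) ℝ) *ᵥ c₁ +
        U.r *ᵥ ((A : Matrix (Fin n ⊕ Fin m) (Fin n ⊕ Fin m) ℝ) *ᵥ c₂) =
      conjRot Ω T.R *ᵥ (c₁ - ϱ *ᵥ c₂) + (ϱ + (Ω : Matrix (Fin d) (Fin d) ℝ) * T.r) *ᵥ c₂ := by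
    rw [Matrix.mulVec_mulVec, hr, hR, Matrix.mulVec_sub, Matrix.mulVec_mulVec, Matrix.sub_mulVec,
      add_comm ϱ]
    simp only [conjRot]
    abel
  constructor
  · rintro ⟨ψ, hψ, c, hc⟩
    obtain ⟨Ω, ϱ, A, h⟩ := (mem_simAut_iff ψ).1 hψ
    refine ⟨Ω, ϱ,
      c ∘ Sum.inl - ϱ *ᵥ (((A⁻¹ : GL _ ℝ) : Matrix (Fin n ⊕ Fin m) (Fin n ⊕ Fin m) ℝ) *ᵥ
      (c ∘ Sum.inr)), ((A⁻¹ : GL _ ℝ) : Matrix (Fin n ⊕ Fin m) (Fin n ⊕ Fin m) ℝ) *ᵥ (c ∘ Sum.inr),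
      fun χ => ?_⟩
    rw [hc, TFG.toMatrix_mulVec_inl, ← key Ω ϱ A _ _ (h _).1 (h _).2, Matrix.mulVec_mulVec,
      Matrix.mulVec_mulVec, Matrix.mul_assoc, Units.mul_inv, Matrix.mul_one]
  · rintro ⟨Ω, ϱ, d₁, d₂, h⟩
    -- A = 1 suffices, so ψ can be inner; adding ϱd₂ to d₁ undoes the shift in `key`.
    refine ⟨_, conjAut_mem_simAut (TFG.ofRot Ω ϱ), Sum.elim (d₁ + ϱ *ᵥ d₂) d₂, fun χ => ?_⟩
    have := key Ω ϱ 1 (TFG.conjAut (TFG.ofRot Ω ϱ) (B χ)) (B χ) rfl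
      (by rw [Units.val_one, Matrix.mul_one, conjAut_r, TFG.ofRot_R, TFG.ofRot_r])
      (d₁ + ϱ *ᵥ d₂) d₂
    rw [h, TFG.toMatrix_mulVec_inl, Sum.elim_comp_inl, Sum.elim_comp_inr]
    simpa using this.symm

theorem isRightObservation_simAut_iff {X : Type*} (B : X → TFG d n m) (w : X → Fin d → ℝ) :
    IsRightObservation (simAut d n m) B w ↔
      ∃ (Ω : SO d) (ϱ : Matrix (Fin d) (Fin n ⊕ Fin m) ℝ)
        (d₁ : Fin d → ℝ) (d₂ : Fin n ⊕ Fin m → ℝ),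
        ∀ χ, w χ = conjRot Ω ((B χ).R)⁻¹ *ᵥ d₁ +
          (ϱ - (Ω : Matrix (Fin d) (Fin d) ℝ) *
            ((((B χ).R)⁻¹ : SO d) : Matrix (Fin d) (Fin d) ℝ) * (B χ).r) *ᵥ d₂ := by
  refine (isLeftObservation_simAut_iff (fun χ => (B χ)⁻¹) w).trans ?_
  simp only [TFG.inv_r, TFG.inv_R, Matrix.mul_neg, sub_eq_add_neg, Matrix.mul_assoc]

end SimAut

/-! ### Rotation and translation parts of the diagonal blocks -/

namespace MFG

variable {d n m s t : ℕ} (χ : MFG d n m s t)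

theorem lBlock_R (j : ℕ) : (χ.lBlock j).R = lRbar χ j 0 :=
  map_succMul TFG.rotHom χ.lT j 0

theorem rBlock_R (j : ℕ) : (χ.rBlock j).R = rRbar χ 0 j :=
  map_succMul TFG.rotHom χ.rT 0 j

/-- A new left factor multiplies every old term by its rotation; the formerly isolated ˡr_j becomes
the last term of the sum. -/
theorem lBlock_r (j : ℕ) : (χ.lBlock j).r = lrBar χ j := by
  induction j with
  | zero => simp [TypeIIExt.lBlock, succMul_self, lrBar, lr]
  | succ j ih =>
    rw [TypeIIExt.lBlock, succMul_succ_zero, TFG.mul_r]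
    change _ * (χ.lBlock j).r + _ = _
    rw [ih, lrBar, lrBar, Finset.sum_range_succ, lRbar, succMul_self, Matrix.mul_add,
      Matrix.mul_sum, add_comm, lr]
    congr 1
    rw [add_comm]
    congr 1
    refine Finset.sum_congr rfl fun k hk => ?_
    rw [lRbar, lRbar, succMul_succ_left _ (Nat.succ_le_of_lt (Finset.mem_range.1 hk)),
      Submonoid.coe_mul, Matrix.mul_assoc]
    rfl

theorem rBlock_r (j : ℕ) : (χ.rBlock j).r = rrBar χ j := by
  induction j with
  | zero => simp [TypeIIExt.rBlock, succMul_self, rrBar, rr]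
  | succ j ih =>
    rw [TypeIIExt.rBlock, succMul_zero_succ, TFG.mul_r]
    change ((χ.rBlock j).R : Matrix (Fin d) (Fin d) ℝ) * _ + (χ.rBlock j).r = _
    rw [ih, rrBar, rrBar, Finset.sum_Icc_succ_top (by omega), rBlock_R, Nat.add_sub_cancel,
      add_comm, add_assoc]
    rfl

/-- In the inductive step the new rotation cancels from every old term, leaving one new summand. -/
theorem lRbar_inv_mul_lrBar (j : ℕ) :
    (((lRbar χ j 0)⁻¹ : SO d) : Matrix (Fin d) (Fin d) ℝ) * lrBar χ j = lrUnder χ j := by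
  rw [← lBlock_R, ← lBlock_r]
  induction j with
  | zero => simp [lrUnder, TypeIIExt.lBlock, lRbar, lR, succMul_self, lr]
  | succ j ih =>
    rw [lrUnder, Finset.sum_range_succ, ← lrUnder, ← ih, ← lBlock_R]
    simp only [TypeIIExt.lBlock, succMul_succ_zero, TFG.mul_r, TFG.mul_R, Matrix.mul_add]
    congr 1
    rw [← Matrix.mul_assoc, ← Submonoid.coe_mul, mul_inv_rev, inv_mul_cancel_right]

/-- Here a new right factor multiplies every old summand by the inverse of its rotation. -/
theorem rRbar_inv_mul_rrBar (j : ℕ) :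
    (((rRbar χ 0 j)⁻¹ : SO d) : Matrix (Fin d) (Fin d) ℝ) * rrBar χ j = rrUnder χ j := by
  rw [← rBlock_r]
  induction j with
  | zero => simp [rrUnder, TypeIIExt.rBlock, rRbar, rR, succMul_self, rr]
  | succ j ih =>
    have h : ∀ k ∈ Finset.range (j + 1),
        (((rRbar χ k (j + 1))⁻¹ : SO d) : Matrix (Fin d) (Fin d) ℝ) * rr χ k =
          (((rR χ (j + 1))⁻¹ : SO d) : Matrix (Fin d) (Fin d) ℝ) *
            ((((rRbar χ k j)⁻¹ : SO d) : Matrix (Fin d) (Fin d) ℝ) * rr χ k) := fun k hk => by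
      rw [rRbar, succMul_succ_right _ (Nat.lt_succ_iff.1 (Finset.mem_range.1 hk)), mul_inv_rev,
        Submonoid.coe_mul, Matrix.mul_assoc]
      rfl
    rw [rrUnder, Finset.sum_range_succ, Finset.sum_congr rfl h, ← Matrix.mul_sum, ← rrUnder, ← ih,
      ← rBlock_R, ← rBlock_R]
    simp only [TypeIIExt.rBlock, succMul_zero_succ, TFG.mul_r, TFG.mul_R, Matrix.mul_add,
      mul_inv_rev, Submonoid.coe_mul, Matrix.mul_assoc]
    rw [add_comm]
    congr 1
    rw [rRbar, succMul_self, ← Matrix.mul_assoc (Subtype.val (TFG.R (succMul _ _ _))⁻¹),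
      TFG.coe_inv_mul_coe, Matrix.one_mul]
    rfl

end MFG

/-! ### Compactness, Schur's lemma and cocycles for the rotation group -/

section SpecialOrthogonal

variable {d : ℕ}

theorem SO.transpose_mul_self (R : SO d) :
    (R : Matrix (Fin d) (Fin d) ℝ)ᵀ * (R : Matrix (Fin d) (Fin d) ℝ) = 1 :=
  TFG.coe_inv_mul_coe R

/-- The rotation with a given orthogonal matrix of determinant one. -/
def SO.ofMatrix (A : Matrix (Fin d) (Fin d) ℝ) (h : A * Aᵀ = 1) (hdet : A.det = 1) : SO d :=
  ⟨A, Matrix.mem_specialOrthogonalGroup_iff.2 ⟨Matrix.mem_unitaryGroup_iff.2 h, hdet⟩⟩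

instance : IsTopologicalGroup (SO d) where
  continuous_inv := Continuous.subtype_mk
    (Continuous.matrix_transpose continuous_subtype_val) _

/-- A closed set of matrices with unit rows, hence with entries in [-1, 1]. Compactness provides a
Haar probability measure. -/
instance : CompactSpace (SO d) := by
  have hK : IsCompact (Set.univ.pi fun _ : Fin d => Set.univ.pi fun _ : Fin d =>
      Set.Icc (-1 : ℝ) 1) := isCompact_univ_pi fun _ => isCompact_univ_pi fun _ => isCompact_Icc
  have hcl : IsClosed {A : Matrix (Fin d) (Fin d) ℝ | A * Aᵀ = 1 ∧ A.det = 1} :=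
    (isClosed_eq (continuous_id.mul continuous_id.matrix_transpose) continuous_const).inter
      (isClosed_eq continuous_id.matrix_det continuous_const)
  have heq : {A : Matrix (Fin d) (Fin d) ℝ | A * Aᵀ = 1 ∧ A.det = 1} =
      (Matrix.specialOrthogonalGroup (Fin d) ℝ : Set (Matrix (Fin d) (Fin d) ℝ)) := by
    ext A
    rw [SetLike.mem_coe, Matrix.mem_specialOrthogonalGroup_iff]
    exact and_congr_left' Matrix.mem_unitaryGroup_iff.symm
  suffices IsCompact (Matrix.specialOrthogonalGroup (Fin d) ℝ : Set (Matrix (Fin d) (Fin d) ℝ)) from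
    isCompact_iff_compactSpace.1 this
  rw [← heq]
  refine hK.of_isClosed_subset hcl ?_
  rintro A ⟨hA, -⟩ i - j -
  have h : ∑ k, A i k * A i k = 1 := by
    exact (congrFun (congrFun hA i) i).trans (Matrix.one_apply_eq i)
  have : A i j * A i j ≤ 1 := h ▸ Finset.single_le_sum (f := fun k => A i k * A i k)
    (fun k _ => mul_self_nonneg _) (Finset.mem_univ j)
  exact abs_le.1 ((sq_le_one_iff_abs_le_one _).1 (by rwa [sq]))

/-- Two distinct indices force d ≥ 2, and oddness excludes d = 2, where the abelian SO(2) would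
defeat the Schur argument. -/
theorem exists_ne_ne_of_odd (hd : Odd d) {a b : Fin d} (h : a ≠ b) : ∃ c, c ≠ a ∧ c ≠ b := by
  have h2 : ({a, b} : Finset (Fin d)).card < (Finset.univ : Finset (Fin d)).card := by
    have hle := Finset.card_le_univ ({a, b} : Finset (Fin d))
    rw [Finset.card_pair h] at hle ⊢
    rw [Finset.card_univ]
    refine lt_of_le_of_ne hle fun e => ?_
    rw [Fintype.card_fin] at e
    rw [← e] at hd
    exact absurd hd (by decide)
  obtain ⟨c, -, hc⟩ := Finset.exists_mem_notMem_of_card_lt_card h2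
  simp only [Finset.mem_insert, Finset.mem_singleton, not_or] at hc
  exact ⟨c, hc⟩

/-- In odd dimension, the matrices commuting with all rotations are scalar. -/
theorem exists_smul_one_of_commute_SO (hd : Odd d) (M : Matrix (Fin d) (Fin d) ℝ)
    (hM : ∀ R : SO d, M * (R : Matrix (Fin d) (Fin d) ℝ) = (R : Matrix (Fin d) (Fin d) ℝ) * M) :
    ∃ a : ℝ, M = a • (1 : Matrix (Fin d) (Fin d) ℝ) := by
  have hoff (a b : Fin d) (hab : a ≠ b) : M a b = 0 := by
    obtain ⟨c, hca, hcb⟩ := exists_ne_ne_of_odd hd hab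
    -- Flipping signs at both a and c keeps the determinant 1, while the (a, b) entry gives -M a b =
    -- M a b.
    let v : Fin d → ℝ := fun i => (if i = a then -1 else 1) * (if i = c then -1 else 1)
    have hv (i) : v i * v i = 1 := by simp only [v]; split_ifs <;> norm_num
    have h := hM (SO.ofMatrix (Matrix.diagonal v)
      (by rw [Matrix.diagonal_transpose, Matrix.diagonal_mul_diagonal]; simp [hv])
      (by rw [Matrix.det_diagonal, Finset.prod_mul_distrib]; simp))
    have h := congrFun (congrFun h a) b
    change (M * Matrix.diagonal v) a b = (Matrix.diagonal v * M) a b at h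
    rw [Matrix.mul_diagonal, Matrix.diagonal_mul] at h
    simp only [v, if_neg hab.symm, if_neg hcb.symm, if_neg hca.symm, if_true] at h
    linarith
  have hdiag (a b : Fin d) : M a a = M b b := by
    by_cases hab : a = b
    · rw [hab]
    obtain ⟨c, hca, hcb⟩ := exists_ne_ne_of_odd hd hab
    -- A 3-cycle is even, so its permutation matrix is a rotation.
    let σ : Equiv.Perm (Fin d) := Equiv.swap a b * Equiv.swap a c
    have hσ : Equiv.Perm.sign σ = 1 := by
      rw [map_mul, Equiv.Perm.sign_swap hab, Equiv.Perm.sign_swap hca.symm]; rfl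
    have hσb : σ b = a := by
      simp [σ, Equiv.swap_apply_of_ne_of_ne (Ne.symm hab) hcb.symm]
    have h := hM (SO.ofMatrix (σ.permMatrix ℝ)
      (by rw [Matrix.transpose_permMatrix, ← Matrix.permMatrix_mul, inv_mul_cancel,
        Matrix.permMatrix_one])
      (by rw [Matrix.det_permutation, hσ]; simp))
    have h := congrFun (congrFun h b) a
    change (M * σ.permMatrix ℝ) b a = (σ.permMatrix ℝ * M) b a at h
    rw [PEquiv.mul_toMatrix_toPEquiv, PEquiv.toMatrix_toPEquiv_mul] at h
    simp only [Matrix.submatrix_apply, id, hσb] at h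
    rw [← h, ← hσb, Equiv.symm_apply_apply]
  obtain ⟨i⟩ : Nonempty (Fin d) := ⟨⟨0, hd.pos⟩⟩
  refine ⟨M i i, ?_⟩
  ext a b
  by_cases hab : a = b
  · subst hab; simp [hdiag a i]
  · simp [hab, hoff a b hab]

/-- In odd dimension, a nonzero matrix `M` with `M R = α(R) M` for all rotations is a nonzero
multiple of a rotation. -/
theorem exists_smul_SO_of_intertwining (hd : Odd d) (α : SO d → SO d)
    (M : Matrix (Fin d) (Fin d) ℝ) (hM0 : M ≠ 0)
    (hM : ∀ R : SO d, M * (R : Matrix (Fin d) (Fin d) ℝ) =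
      (α R : Matrix (Fin d) (Fin d) ℝ) * M) :
    ∃ (a : ℝ) (Ω : SO d), a ≠ 0 ∧ M = a • (Ω : Matrix (Fin d) (Fin d) ℝ) := by
  -- Orthogonality of α(R) gives RᵀMᵀMR = MᵀM. The resulting scalar is the squared norm of each
  -- column.
  obtain ⟨a, ha⟩ := exists_smul_one_of_commute_SO hd (Mᵀ * M) fun R => by
    have h : (R : Matrix (Fin d) (Fin d) ℝ)ᵀ * (Mᵀ * M * (R : Matrix (Fin d) (Fin d) ℝ)) =
        Mᵀ * M := by
      rw [Matrix.mul_assoc, hM, ← Matrix.mul_assoc, ← Matrix.transpose_mul, hM,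
        Matrix.transpose_mul, Matrix.mul_assoc, ← Matrix.mul_assoc _ _ M, SO.transpose_mul_self,
        Matrix.one_mul]
    have h2 : (R : Matrix (Fin d) (Fin d) ℝ) * (R : Matrix (Fin d) (Fin d) ℝ)ᵀ = 1 :=
      TFG.coe_mul_coe_inv R
    calc Mᵀ * M * (R : Matrix (Fin d) (Fin d) ℝ)
      _ = ((R : Matrix (Fin d) (Fin d) ℝ) * (R : Matrix (Fin d) (Fin d) ℝ)ᵀ) *
          (Mᵀ * M * (R : Matrix (Fin d) (Fin d) ℝ)) := by rw [h2, Matrix.one_mul]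
      _ = _ := by rw [Matrix.mul_assoc, h]
  have hi (i : Fin d) : ∑ k, M k i * M k i = a := by
    simpa [Matrix.mul_apply] using congrFun (congrFun ha i) i
  have hapos : 0 < a := by
    obtain ⟨k, i, hki⟩ : ∃ k i, M k i ≠ 0 := by
      by_contra! h
      exact hM0 (Matrix.ext h)
    rw [← hi i]
    exact Finset.sum_pos' (fun k _ => mul_self_nonneg _)
      ⟨k, Finset.mem_univ _, mul_self_pos.2 hki⟩
  set b := Real.sqrt a with hb
  have hb0 : b ≠ 0 := (Real.sqrt_pos.2 hapos).ne'
  have hbb : b * b = a := Real.mul_self_sqrt hapos.le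
  have horth : (b⁻¹ • M) * (b⁻¹ • M)ᵀ = 1 := by
    refine mul_eq_one_comm.1 ?_
    rw [Matrix.transpose_smul, Matrix.smul_mul, Matrix.mul_smul, ha, smul_smul, smul_smul, ← hbb]
    rw [show b⁻¹ * b⁻¹ * (b * b) = 1 by field_simp, one_smul]
  have hdet : (b⁻¹ • M).det = 1 ∨ (b⁻¹ • M).det = -1 := by
    have := congrArg Matrix.det horth
    rw [Matrix.det_mul, Matrix.det_transpose, Matrix.det_one] at this
    exact mul_self_eq_one_iff.1 this
  rcases hdet with h | h
  · exact ⟨b, SO.ofMatrix _ horth h, hb0, (smul_inv_smul₀ hb0 M).symm⟩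
  -- In odd dimension a sign change turns determinant -1 into 1.
  · refine ⟨-b, SO.ofMatrix (-(b⁻¹ • M)) ?_ ?_, neg_ne_zero.2 hb0, ?_⟩
    · rw [Matrix.transpose_neg, neg_mul_neg, horth]
    · rw [Matrix.det_neg, Fintype.card_fin, hd.neg_one_pow, h]; norm_num
    · exact (by rw [neg_smul_neg, smul_inv_smul₀ hb0] : M = -b • -(b⁻¹ • M))

open MeasureTheory in
/-- A continuous cocycle of `SO(d)` with values in a space of matrices is a coboundary. -/
theorem exists_coboundary_SO {k : Type*} (α : SO d → Matrix (Fin d) (Fin d) ℝ)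
    (b : SO d → Matrix (Fin d) k ℝ) (hb : Continuous b)
    (hcoc : ∀ R R', b (R * R') = b R + α R * b R') :
    ∃ ρ : Matrix (Fin d) k ℝ, ∀ R, b R = ρ - α R * ρ := by
  borelize (SO d)
  let μ : Measure (SO d) := Measure.haarMeasure ⊤
  have : IsProbabilityMeasure μ := ⟨by
    simpa using Measure.haarMeasure_self (K₀ := (⊤ : TopologicalSpace.PositiveCompacts (SO d)))⟩
  have hint (i j) : Integrable (fun R => b R i j) μ :=
    (hb.matrix_elem i j).integrable_of_hasCompactSupport (HasCompactSupport.of_compactSpace _)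
  -- Take ρ to be the mean of b. Integrating b(RQ) = b(R) + α(R)b(Q) over Q gives ρ = b(R) + α(R)ρ
  -- by left invariance.
  refine ⟨Matrix.of fun i j => ∫ R, b R i j ∂μ, fun R => ?_⟩
  ext i j
  have h := integral_mul_left_eq_self (μ := μ) (fun Q => b Q i j) R
  simp only [hcoc, Matrix.add_apply, Matrix.mul_apply] at h
  rw [integral_add (integrable_const _)
    (integrable_finsetSum _ fun k _ => (hint k j).const_mul _), integral_const,
    integral_finsetSum _ fun k _ => (hint k j).const_mul _] at h
  simp only [integral_const_mul, probReal_univ, one_smul] at h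
  rw [Matrix.sub_apply, Matrix.mul_apply]
  simp only [Matrix.of_apply]
  linarith

end SpecialOrthogonal

/-! ### Classification of the bicontinuous automorphisms in odd dimension -/

section Automorphisms

variable {d n m : ℕ}

/-- A rotation `Q` with `(1 - Q)² = 0` is trivial. -/
theorem SO.eq_one_of_sub_mul_sub (Q : SO d)
    (h : (1 - (Q : Matrix (Fin d) (Fin d) ℝ)) * (1 - (Q : Matrix (Fin d) (Fin d) ℝ)) = 0) :
    Q = 1 := by
  set A := 1 - (Q : Matrix (Fin d) (Fin d) ℝ) with hA
  -- This turns A² = 0 into AᵀA = 0, which forces A = 0.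
  have hT : Aᵀ = -((Q : Matrix (Fin d) (Fin d) ℝ)ᵀ * A) := by
    rw [hA, Matrix.mul_sub, SO.transpose_mul_self, Matrix.mul_one, Matrix.transpose_sub,
      Matrix.transpose_one, neg_sub]
  have h0 : Aᵀ * A = 0 := by
    rw [hT, Matrix.neg_mul, Matrix.mul_assoc, h, Matrix.mul_zero, neg_zero]
  rw [← Matrix.conjTranspose_eq_transpose_of_trivial, Matrix.conjTranspose_mul_self_eq_zero] at h0
  exact Subtype.ext (sub_eq_zero.1 h0).symm

/-- Automorphisms preserve the translation subgroup, because its image is abelian and normal. -/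
theorem TFG.aut_translation_R (hk : 0 < n + m) (ψ : TFG d n m ≃* TFG d n m)
    (v : Matrix (Fin d) (Fin n ⊕ Fin m) ℝ) : (ψ (TFG.ofRot 1 v)).R = 1 := by
  set P := ψ (TFG.ofRot 1 v) with hP
  -- Any conjugate of a translation is a translation, so P commutes with its conjugate by (1, w);
  -- comparing translation parts gives (1 - P.R)²w = 0.
  have key (w : Matrix (Fin d) (Fin n ⊕ Fin m) ℝ) :
      (1 - (P.R : Matrix (Fin d) (Fin d) ℝ)) * ((1 - (P.R : Matrix (Fin d) (Fin d) ℝ)) * w) = 0 := by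
    obtain ⟨u, hu⟩ := ψ.surjective (TFG.ofRot 1 w)
    have hc : Commute (u * TFG.ofRot 1 v * u⁻¹) (TFG.ofRot 1 v) :=
      TFG.ext_r (by simp) (by simp [TFG.inv_r, ← Matrix.mul_assoc, coe_mul_coe_inv, add_comm])
    have hc := hc.map ψ
    rw [map_mul, map_mul, map_inv, hu, ← hP] at hc
    have hr := congrArg TFG.r hc.eq
    simp only [TFG.mul_r, TFG.mul_R, TFG.inv_r, TFG.ofRot_R, TFG.ofRot_r, TFG.inv_R, inv_one,
      one_mul, mul_one, Submonoid.coe_one, Matrix.one_mul] at hr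
    simp only [Matrix.sub_mul, Matrix.mul_sub, Matrix.one_mul, Matrix.mul_add, Matrix.mul_neg]
      at hr ⊢
    rw [← sub_eq_zero.2 hr]
    abel
  refine SO.eq_one_of_sub_mul_sub _ (Matrix.ext fun a x => ?_)
  obtain ⟨i⟩ : Nonempty (Fin n ⊕ Fin m) :=
    Fintype.card_pos_iff.1 (by simpa [Fintype.card_sum] using hk)
  have h := congrFun (congrFun (key (Matrix.single x i 1)) a) i
  rw [← Matrix.mul_assoc] at h
  simpa using h

theorem TFG.continuous_ofRot :
    Continuous fun p : SO d × Matrix (Fin d) (Fin n ⊕ Fin m) ℝ => TFG.ofRot p.1 p.2 :=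
  TFG.continuous_of_coe (continuous_subtype_val.comp continuous_fst)
    (by simpa using continuous_snd)

/-- The action of an automorphism on translations, as a linear map. -/
def TFG.autTranslation (hk : 0 < n + m) (ψ : TFG d n m ≃ₜ* TFG d n m) :
    Matrix (Fin d) (Fin n ⊕ Fin m) ℝ →L[ℝ] Matrix (Fin d) (Fin n ⊕ Fin m) ℝ :=
  -- A continuous additive map is real-linear.
  AddMonoidHom.toRealLinearMap
    (AddMonoidHom.mk' (fun v => (ψ (TFG.ofRot 1 v)).r) fun v w => by
      have h : (TFG.ofRot 1 (v + w) : TFG d n m) = TFG.ofRot 1 v * TFG.ofRot 1 w := by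
        rw [TFG.ofRot_mul]; simp [add_comm]
      have hv : (ψ (TFG.ofRot 1 v)).R = 1 := TFG.aut_translation_R hk ψ.toMulEquiv v
      rw [h, map_mul, TFG.mul_r, hv, Submonoid.coe_one, Matrix.one_mul, add_comm])
    (TFG.continuous_r.comp (ψ.continuous.comp
      (TFG.continuous_ofRot.comp (Continuous.prodMk_right 1))))

theorem TFG.aut_translation (hk : 0 < n + m) (ψ : TFG d n m ≃ₜ* TFG d n m)
    (v : Matrix (Fin d) (Fin n ⊕ Fin m) ℝ) :
    ψ (TFG.ofRot 1 v) = TFG.ofRot 1 (TFG.autTranslation hk ψ v) :=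
  TFG.ext_r (TFG.aut_translation_R hk ψ.toMulEquiv v) (TFG.ofRot_r _ _).symm

theorem TFG.autTranslation_injective (hk : 0 < n + m) (ψ : TFG d n m ≃ₜ* TFG d n m) :
    Function.Injective (TFG.autTranslation hk ψ) := fun v w h => by
  have := ψ.injective ((TFG.aut_translation hk ψ v).trans
    ((congrArg _ h).trans (TFG.aut_translation hk ψ w).symm))
  simpa using congrArg TFG.r this

/-- Apply ψ to (1, Rv)(R, 0) = (R, 0)(1, v). -/
theorem TFG.autTranslation_rot_mul (hk : 0 < n + m) (ψ : TFG d n m ≃ₜ* TFG d n m) (R : SO d)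
    (v : Matrix (Fin d) (Fin n ⊕ Fin m) ℝ) :
    TFG.autTranslation hk ψ ((R : Matrix (Fin d) (Fin d) ℝ) * v) =
      ((ψ (TFG.ofRot R 0)).R : Matrix (Fin d) (Fin d) ℝ) * TFG.autTranslation hk ψ v := by
  have h : (TFG.ofRot 1 ((R : Matrix (Fin d) (Fin d) ℝ) * v) : TFG d n m) * TFG.ofRot R 0 =
      TFG.ofRot R 0 * TFG.ofRot 1 v := by
    rw [TFG.ofRot_mul, TFG.ofRot_mul]; simp
  have h := congrArg (fun T => (ψ T).r) h
  simp only [map_mul, TFG.aut_translation hk, TFG.mul_r, TFG.ofRot_R, TFG.ofRot_r,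
    Submonoid.coe_one, Matrix.one_mul] at h
  rw [add_comm] at h
  exact add_right_cancel h

/-- In odd dimension, an injective linear map `L` of `ℝ^{d×k}` with `L(Rv) = α(R) L(v)` for all
rotations `R` is `v ↦ Ω v B` with `Ω` a rotation and `B` invertible, and `α` is conjugation
by `Ω`. -/
theorem exists_eq_mul_mul_of_equivariant {k : Type*} [Fintype k] [DecidableEq k] [Nonempty k]
    (hd : Odd d) (α : SO d → SO d)
    (L : Matrix (Fin d) k ℝ →ₗ[ℝ] Matrix (Fin d) k ℝ) (hL : Function.Injective L)
    (hα : ∀ (R : SO d) (v : Matrix (Fin d) k ℝ), L ((R : Matrix (Fin d) (Fin d) ℝ) * v) =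
      (α R : Matrix (Fin d) (Fin d) ℝ) * L v) :
    ∃ (Ω : SO d) (B : GL k ℝ), (∀ R, α R = MulAut.conj Ω R) ∧
      ∀ v, L v = (Ω : Matrix (Fin d) (Fin d) ℝ) * v * (B : Matrix k k ℝ) := by
  -- The block of L from input column i to output column j; each block intertwines R with α(R).
  let M (i j : k) : Matrix (Fin d) (Fin d) ℝ := Matrix.of fun a x => L (Matrix.single x i 1) a j
  have hLM (v : Matrix (Fin d) k ℝ) (a : Fin d) (j : k) :
      L v a j = ∑ x, ∑ i, v x i * M i j a x := by
    conv_lhs => rw [Matrix.matrix_eq_sum_single v]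
    simp only [map_sum, Matrix.sum_apply]
    refine Finset.sum_congr rfl fun x _ => Finset.sum_congr rfl fun i _ => ?_
    rw [← mul_one (v x i), ← smul_eq_mul (v x i) 1, ← Matrix.smul_single, map_smul,
      Matrix.smul_apply, smul_eq_mul, smul_eq_mul, mul_one]
    rfl
  have hM (i j : k) (R : SO d) : M i j * (R : Matrix (Fin d) (Fin d) ℝ) =
      (α R : Matrix (Fin d) (Fin d) ℝ) * M i j := by
    ext a x
    have h := congrFun (congrFun (hα R (Matrix.single x i 1)) a) j
    rw [hLM] at h
    refine Eq.trans ?_ (h.trans (Matrix.mul_apply ..))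
    rw [Matrix.mul_apply]
    refine Finset.sum_congr rfl fun y _ => ?_
    rw [Finset.sum_eq_single i]
    · simp [mul_comm]
    · intro i' _ hi'
      rw [Matrix.mul_single_apply_of_ne _ _ _ _ _ hi', zero_mul]
    · simp
  have hd0 : Nonempty (Fin d) := ⟨⟨0, hd.pos⟩⟩
  obtain ⟨i₀, j₀, h₀⟩ : ∃ i j, M i j ≠ 0 := by
    by_contra! h
    have : L (Matrix.of fun _ _ => 1) = L 0 := by
      ext a j
      simp [hLM, h]
    simpa using congrFun (congrFun (hL this) (Classical.arbitrary _)) (Classical.arbitrary _)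
  obtain ⟨c, Ω, hc, hΩ⟩ := exists_smul_SO_of_intertwining hd α _ h₀ (hM i₀ j₀)
  have hαΩ (R : SO d) : α R * Ω = Ω * R := by
    have h := hM i₀ j₀ R
    rw [hΩ, Matrix.smul_mul, Matrix.mul_smul] at h
    exact Subtype.ext (smul_right_injective _ hc h).symm
  have hαc (R : SO d) : α R = MulAut.conj Ω R := by
    rw [MulAut.conj_apply, eq_mul_inv_iff_mul_eq, hαΩ]
  -- Now that α is conjugation by Ω, each Ω⁻¹M_ij commutes with all rotations, so it is scalar.
  have hB (i j : k) : ∃ b : ℝ, M i j = b • (Ω : Matrix (Fin d) (Fin d) ℝ) := by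
    obtain ⟨b, hb⟩ := exists_smul_one_of_commute_SO hd
      (((Ω⁻¹ : SO d) : Matrix (Fin d) (Fin d) ℝ) * M i j) fun R => by
        rw [Matrix.mul_assoc, hM, ← Matrix.mul_assoc, ← Matrix.mul_assoc, ← Submonoid.coe_mul,
          ← Submonoid.coe_mul, hαc, MulAut.conj_apply, ← mul_assoc, ← mul_assoc, inv_mul_cancel,
          one_mul]
    refine ⟨b, ?_⟩
    have := congrArg (fun Z => (Ω : Matrix (Fin d) (Fin d) ℝ) * Z) hb
    simpa [← Matrix.mul_assoc, TFG.coe_mul_coe_inv] using this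
  choose B hB using hB
  have hLB (v : Matrix (Fin d) k ℝ) :
      L v = (Ω : Matrix (Fin d) (Fin d) ℝ) * v * (Matrix.of B : Matrix k k ℝ) := by
    ext a j
    rw [hLM, Matrix.mul_apply, Finset.sum_comm]
    refine Finset.sum_congr rfl fun i _ => ?_
    rw [Matrix.mul_apply, Finset.sum_mul]
    refine Finset.sum_congr rfl fun x _ => ?_
    rw [hB, Matrix.smul_apply, Matrix.of_apply, smul_eq_mul]
    ring
  -- Matrices with all rows equal to u transfer injectivity from L to B.
  have hinj : Function.Injective fun u : k → ℝ => u ᵥ* (Matrix.of B : Matrix k k ℝ) := by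
    intro u u' h
    have : L (Matrix.of fun _ => u) = L (Matrix.of fun _ => u') := by
      rw [hLB, hLB, Matrix.mul_assoc, Matrix.mul_assoc]
      congr 1
      exact funext fun _ => h
    exact congrFun (hL this) (Classical.arbitrary _)
  obtain ⟨B', hB'⟩ := Matrix.vecMul_injective_iff_isUnit.1 hinj
  exact ⟨Ω, B', hαc, fun v => by rw [hLB, hB']⟩

/-- For odd `d`, if there is at least one vector, every bicontinuous automorphism of `TFG(d,n,m)`
is a conjugation by a similarity matrix. -/
theorem simAut_eq_univ (hd : Odd d) (hk : 0 < n + m) : simAut d n m = Set.univ := by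
  refine Set.eq_univ_of_forall fun ψ => ?_
  have : Nonempty (Fin n ⊕ Fin m) :=
    Fintype.card_pos_iff.1 (by simpa [Fintype.card_sum] using hk)
  obtain ⟨Ω, B, hα, hL⟩ := exists_eq_mul_mul_of_equivariant hd (fun R => (ψ (TFG.ofRot R 0)).R)
    (TFG.autTranslation hk ψ).toLinearMap (TFG.autTranslation_injective hk ψ)
    (TFG.autTranslation_rot_mul hk ψ)
  obtain ⟨ρ, hρ⟩ := exists_coboundary_SO
    (fun R => ((ψ (TFG.ofRot R 0)).R : Matrix (Fin d) (Fin d) ℝ))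
    (fun R => (ψ (TFG.ofRot R 0)).r)
    (TFG.continuous_r.comp (ψ.continuous.comp
      (TFG.continuous_ofRot.comp (Continuous.prodMk_left 0))))
    fun R R' => by
      have h : (TFG.ofRot (R * R') 0 : TFG d n m) = TFG.ofRot R 0 * TFG.ofRot R' 0 := by
        rw [TFG.ofRot_mul]; simp
      rw [h, map_mul, TFG.mul_r, add_comm]
  -- From T = (1, r)(R, 0), the translation part of ψ(T) is ΩrB + ρ - α(R)ρ; multiplying by A = B⁻¹
  -- gives the required form with ϱ = ρB⁻¹.
  refine (mem_simAut_iff ψ).2 ⟨Ω, ρ * ((B⁻¹ : GL _ ℝ) : Matrix (Fin n ⊕ Fin m) (Fin n ⊕ Fin m) ℝ),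
    B⁻¹, fun T => ?_⟩
  have hT : ψ T = TFG.ofRot 1 (TFG.autTranslation hk ψ T.r) * ψ (TFG.ofRot T.R 0) := by
    rw [← TFG.aut_translation, ← map_mul, TFG.ofRot_mul]
    simp [TFG.ofRot_eta]
  have hL' : TFG.autTranslation hk ψ T.r = _ := hL T.r
  constructor
  · rw [hT, TFG.mul_R, TFG.ofRot_R, one_mul, hα]
  · rw [hT, TFG.mul_r, TFG.ofRot_R, TFG.ofRot_r, hL', hρ, hα, Submonoid.coe_one, Matrix.one_mul,
      conjRot, Matrix.add_mul, Matrix.sub_mul, Matrix.mul_assoc (_ * T.r),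
      Units.mul_inv, Matrix.mul_one, Matrix.mul_assoc]
    abel

end Automorphisms

end

/-! ### The six observation formulas -/

theorem mainTheorem3 (d n m s t : ℕ) (𝒜 : Set (TFG d n m ≃ₜ* TFG d n m))
    (h𝒜 : 𝒜 = simAut d n m ∨ (𝒜 = Set.univ ∧ Odd d ∧ 0 < n + m))
    (w : MFG d n m s t → Fin d → ℝ) :
    -- left action, block `T_0`
    (IsLeftObservation 𝒜 (fun χ : MFG d n m s t => χ.core) w ↔
      ∃ (Ω : SO d) (ϱ : Matrix (Fin d) (Fin n ⊕ Fin m) ℝ)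
        (d₁ : Fin d → ℝ) (d₂ : Fin n ⊕ Fin m → ℝ),
        ∀ χ : MFG d n m s t, w χ = conjRot Ω χ.core.R *ᵥ d₁ +
          ((Ω : Matrix (Fin d) (Fin d) ℝ) * χ.core.r + ϱ) *ᵥ d₂) ∧
    -- left action, block `ˡT_j ⋯ T_0`
    (∀ j : ℕ, 1 ≤ j → j ≤ s →
      (IsLeftObservation 𝒜 (fun χ : MFG d n m s t => χ.lBlock j) w ↔
        ∃ (Ω : SO d) (ϱ : Matrix (Fin d) (Fin n ⊕ Fin m) ℝ)
          (d₁ : Fin d → ℝ) (d₂ : Fin n ⊕ Fin m → ℝ),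
          ∀ χ : MFG d n m s t, w χ = conjRot Ω (MFG.lRbar χ j 0) *ᵥ d₁ +
            (ϱ + (Ω : Matrix (Fin d) (Fin d) ℝ) * MFG.lrBar χ j) *ᵥ d₂)) ∧
    -- left action, block `T_0 ⋯ ʳT_j`
    (∀ j : ℕ, 1 ≤ j → j ≤ t →
      (IsLeftObservation 𝒜 (fun χ : MFG d n m s t => χ.rBlock j) w ↔
        ∃ (Ω : SO d) (ϱ : Matrix (Fin d) (Fin n ⊕ Fin m) ℝ)
          (d₁ : Fin d → ℝ) (d₂ : Fin n ⊕ Fin m → ℝ),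
          ∀ χ : MFG d n m s t, w χ = conjRot Ω (MFG.rRbar χ 0 j) *ᵥ d₁ +
            (ϱ + (Ω : Matrix (Fin d) (Fin d) ℝ) * MFG.rrBar χ j) *ᵥ d₂)) ∧
    -- right action, block `T_0`
    (IsRightObservation 𝒜 (fun χ : MFG d n m s t => χ.core) w ↔
      ∃ (Ω : SO d) (ϱ : Matrix (Fin d) (Fin n ⊕ Fin m) ℝ)
        (d₁ : Fin d → ℝ) (d₂ : Fin n ⊕ Fin m → ℝ),
        ∀ χ : MFG d n m s t, w χ = conjRot Ω (χ.core.R)⁻¹ *ᵥ d₁ +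
          (ϱ - (Ω : Matrix (Fin d) (Fin d) ℝ) *
            (((χ.core.R)⁻¹ : SO d) : Matrix (Fin d) (Fin d) ℝ) * χ.core.r) *ᵥ d₂) ∧
    -- right action, block `ˡT_j ⋯ T_0`
    (∀ j : ℕ, 1 ≤ j → j ≤ s →
      (IsRightObservation 𝒜 (fun χ : MFG d n m s t => χ.lBlock j) w ↔
        ∃ (Ω : SO d) (ϱ : Matrix (Fin d) (Fin n ⊕ Fin m) ℝ)
          (d₁ : Fin d → ℝ) (d₂ : Fin n ⊕ Fin m → ℝ),
          ∀ χ : MFG d n m s t, w χ = conjRot Ω (MFG.lRbar χ j 0)⁻¹ *ᵥ d₁ +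
            (ϱ - (Ω : Matrix (Fin d) (Fin d) ℝ) * MFG.lrUnder χ j) *ᵥ d₂)) ∧
    -- right action, block `T_0 ⋯ ʳT_j`
    (∀ j : ℕ, 1 ≤ j → j ≤ t →
      (IsRightObservation 𝒜 (fun χ : MFG d n m s t => χ.rBlock j) w ↔
        ∃ (Ω : SO d) (ϱ : Matrix (Fin d) (Fin n ⊕ Fin m) ℝ)
          (d₁ : Fin d → ℝ) (d₂ : Fin n ⊕ Fin m → ℝ),
          ∀ χ : MFG d n m s t, w χ = conjRot Ω (MFG.rRbar χ 0 j)⁻¹ *ᵥ d₁ +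
            (ϱ - (Ω : Matrix (Fin d) (Fin d) ℝ) * MFG.rrUnder χ j) *ᵥ d₂)) := by
  have h : 𝒜 = simAut d n m := h𝒜.elim id fun h => h.1.trans (simAut_eq_univ h.2.1 h.2.2).symm
  subst h
  refine ⟨?_, fun j _ _ => ?_, fun j _ _ => ?_, ?_, fun j _ _ => ?_, fun j _ _ => ?_⟩
  · simpa only [add_comm] using isLeftObservation_simAut_iff (fun χ : MFG d n m s t => χ.core) w
  · simpa only [MFG.lBlock_R, MFG.lBlock_r] using
      isLeftObservation_simAut_iff (fun χ : MFG d n m s t => χ.lBlock j) w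
  · simpa only [MFG.rBlock_R, MFG.rBlock_r] using
      isLeftObservation_simAut_iff (fun χ : MFG d n m s t => χ.rBlock j) w
  · exact isRightObservation_simAut_iff (fun χ : MFG d n m s t => χ.core) w
  · simpa only [MFG.lBlock_R, MFG.lBlock_r, Matrix.mul_assoc, MFG.lRbar_inv_mul_lrBar] using
      isRightObservation_simAut_iff (fun χ : MFG d n m s t => χ.lBlock j) w
  · simpa only [MFG.rBlock_R, MFG.rBlock_r, Matrix.mul_assoc, MFG.rRbar_inv_mul_rrBar] using
      isRightObservation_simAut_iff (fun χ : MFG d n m s t => χ.rBlock j) w
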